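/- Corollary (the fundamental group of $X_{i,j/\sigma}$ is $\mathbb{Z}$). Let $N\ge 0$ be an integer and let $\overline\Gamma=(\mathbb{R}^2)^N\cong\mathbb{R}^{2N}$ be the joint configuration space of $N$ point robots in the plane, with points $\mathbf p=(x_1,y_1,\dots,x_N,y_N)$. For $1\le i<j\le N$ let $\mathcal O_{i,j}=\{\mathbf p : x_i=x_j,\ y_i=y_j\}$, and let $X=\overline\Gamma\setminus\bigcup_{1\le i<j\le N}\mathcal O_{i,j}$ be the coordination space. For $1\le i<j\le N$ and signs $\sigma=(\sigma_{i+1},\dots,\sigma_{j-1})$, $\sigma_n\in\{+,-\}$, let $$\mathcal U_{i,j/\sigma}=\{\mathbf p : x_i=x_j,\ y_i<y_j,\ \text{and for all } i<n<j:\ x_i=x_j\le x_n \text{ if } \sigma_n=-,\ \ x_i=x_j\ge x_n \text{ if } \sigma_n=+\}.$$ For each such $(i,j,\sigma)$ put $$X_{i,j/\sigma}=X\setminus\bigcup_{(i',j',\varsigma)\ne(i,j,\sigma)}\mathcal U_{i',j'/\varsigma}.$$ Then $X_{i,j/\sigma}$ is path connected, and its fundamental group (at every base point) is isomorphic to $\mathbb{Z}$.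 Moreover, the sets $U_{i,j/\sigma}:=\mathcal U_{i,j/\sigma}\cap X$ have the following properties. (a) $X$ is an open subset of $\mathbb{R}^{2N}$ (so a $2N$-manifold without boundary). Each $U_{i,j/\sigma}$ is closed in $X$ and is an orientable smooth embedded hypersurface with boundary and corners (locally, in smooth coordinates $u_1,\dots,u_{2N}$ of $\mathbb{R}^{2N}$, it is $\{u_c=0,\ u_k\ge0 \text{ for } k\in J\}$ with $c\notin J$; orientable means that it has a continuous nowhere vanishing conormal field). Its boundary $\partial U_{i,j/\sigma}$ (the points near which it is not a smooth hypersurface without boundary) is contained in the union of the other $U_{i',j'/\varsigma}$. (b) Let $\mathbf p$ be a common point of two pieces $U_{i,j/\sigma}$ and $U_{i',j'/\varsigma}$ with $(i,j,\sigma)\neq(i',j',\varsigma)$. If $(i,j)\ne(i',j')$, then the tangent spaces of the two pieces at $\mathbf p$ together span $\mathbb{R}^{2N}$ (the tangent space at a boundary point being the full $(2N-1)$-dimensional one). If $(i,j)=(i',j')$, then $\mathbf p$ lies in the boundary of both pieces. (c) The complement $X\setminus\bigcup_{(i,j,\sigma)}\mathcal U_{i,j/\sigma}$ of all the pieces is path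 connected and simply connected. -/

import Mathlib

open scoped ContDiff

/-- The joint configuration space of `N` point robots in the Euclidean plane (collisions included).
The robot `i` is at `(p i 0, p i 1) = (x_i, y_i)`; as a manifold this is `ℝ ^ (2 * N)`. -/
abbrev Config (N : ℕ) : Type := Fin N → EuclideanSpace ℝ (Fin 2)

/-- The obstacle `𝒪_{i,j}`: robots `i` and `j` collide. -/
def collisionSet {N : ℕ} (i j : Fin N) : Set (Config N) :=
  {p | p i 0 = p j 0 ∧ p i 1 = p j 1}

/-- The coordination space `X`: no two robots collide. -/
def coordinationSpace (N : ℕ) : Set (Config N) :=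
  Set.univ \ ⋃ (i : Fin N) (j : Fin N) (_ : i < j), collisionSet i j

/-- The signs `-` and `+`. -/
inductive PieceSign : Type
  | minus : PieceSign
  | plus : PieceSign

/-- The index `(i, j, σ_{i+1}, …, σ_{j-1})` of a split half-hyperplane: a pair `i < j` and a sign
for every index strictly between `i` and `j`. -/
structure SplitIndex (N : ℕ) : Type where
  i : Fin N
  j : Fin N
  lt : i < j
  σ : Set.Ioo i j → PieceSign

/-- The split half-hyperplane `𝒰_{i,j/σ}`: `x_i = x_j`, `y_i < y_j`, and for `i < n < j`
`x_i = x_j ≤ x_n` if `σ_n` is `-`, `x_i = x_j ≥ x_n` if `σ_n` is `+`. -/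
def splitHalfHyperplane {N : ℕ} (α : SplitIndex N) : Set (Config N) :=
  {p | p α.i 0 = p α.j 0 ∧ p α.i 1 < p α.j 1 ∧
    ∀ n : Set.Ioo α.i α.j,
      match α.σ n with
      | PieceSign.minus => p α.i 0 ≤ p n 0
      | PieceSign.plus => p α.i 0 ≥ p n 0}

/-- The part of `𝒰_{i,j/σ}` that lies in the coordination space. -/
def splitPiece {N : ℕ} (α : SplitIndex N) : Set (Config N) :=
  splitHalfHyperplane α ∩ coordinationSpace N

/-- `X_{i,j/σ}`: the coordination space without the split half-hyperplanes other than
`𝒰_{i,j/σ}`. -/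
def singlePieceSpace {N : ℕ} (α : SplitIndex N) : Set (Config N) :=
  coordinationSpace N \ ⋃ (β : SplitIndex N) (_ : β ≠ α), splitHalfHyperplane β

section Hypersurfaces

/-- Near `p` there are smooth coordinates `u_1, …, u_D` of the ambient space in which `S` is
`{u_c = 0, u_k ≥ 0 for k ∈ J}`. -/
def HasCornerChartAt {E : Type*} [NormedAddCommGroup E] [NormedSpace ℝ E]
    (D : ℕ) (S : Set E) (p : E) (c : Fin D) (J : Set (Fin D)) : Prop :=
  ∃ φ : OpenPartialHomeomorph E (Fin D → ℝ),
    p ∈ φ.source ∧ ContDiffOn ℝ ∞ φ φ.source ∧ ContDiffOn ℝ ∞ φ.symm φ.target ∧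
      φ '' (S ∩ φ.source) = φ.target ∩ {u | u c = 0 ∧ ∀ k ∈ J, 0 ≤ u k}

/-- `S` is a smooth embedded hypersurface, possibly with boundary and corners, of a
`D`-dimensional space. -/
def IsHypersurfaceWithCorners {E : Type*} [NormedAddCommGroup E] [NormedSpace ℝ E]
    (D : ℕ) (S : Set E) : Prop :=
  ∀ p ∈ S, ∃ (c : Fin D) (J : Set (Fin D)), c ∉ J ∧ HasCornerChartAt D S p c J

/-- The boundary of a hypersurface with corners: the points near which it is not a smooth
hypersurface without boundary. -/
def hypersurfaceBoundary {E : Type*} [NormedAddCommGroup E] [NormedSpace ℝ E]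
    (D : ℕ) (S : Set E) : Set E :=
  {p | p ∈ S ∧ ¬ ∃ c : Fin D, HasCornerChartAt D S p c ∅}

/-- The tangent space of a hypersurface with corners at `p` (at a boundary point this is the whole
hyperplane, not only the inward directions). -/
def hypersurfaceTangentSpace {E : Type*} [NormedAddCommGroup E] [NormedSpace ℝ E]
    (S : Set E) (p : E) : Submodule ℝ E :=
  Submodule.span ℝ (tangentConeAt ℝ S p)

/-- Orientability of a hypersurface of a vector space, as the existence of a continuous nowhere
vanishing conormal field (which is what gives a sign to each transverse crossing). -/
def IsOrientableHypersurface {E : Type*} [NormedAddCommGroup E] [NormedSpace ℝ E]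
    (S : Set E) : Prop :=
  ∃ ν : E → (E →L[ℝ] ℝ), ContinuousOn ν S ∧
    ∀ p ∈ S, ν p ≠ 0 ∧ (ν p).toLinearMap.ker = hypersurfaceTangentSpace S p

end Hypersurfaces

/-!
The space `X_{i,j/σ}` is the set of configurations in which every pair `k < l` other than `(i, j)`
satisfies `x_k = x_l → y_l < y_k`, and in which `x_i = x_j` implies either `y_j < y_i` or
`y_i < y_j` together with the strict inequalities prescribed by `σ` for the robots between `i` and
`j` (`mem_singlePieceSpace_iff`). This rests on the fact that, for a fixed pair, the half-hyperplanes
of all sign vectors cover `x_i = x_j`, `y_i < y_j`.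

Its fundamental group comes from an explicit homotopy equivalence with the circle. The function
`exchangeRatio`, with values in `[0, 1]`, is `1` exactly on the piece and `0` wherever robots `i`
and `j` may not be exchanged. It has two uses. The vector
`(x_j - x_i, 2 * exchangeRatio - 1)` never vanishes, which gives the map `windingMap` to the circle.
And it tells how far robots `i` and `j` have to change places in the decreasing stack `y_k = -k`
(`modelY`), so that all second coordinates can be moved linearly to this model position without
leaving the space. After that, the order of the robots is correct wherever their first
coordinates may coincide, and the first coordinates can be moved linearly to those of a loop
(`modelLoop`) in which robots `i` and `j` turn around each other and the robots between them keep
to the sides given by `σ`. The fundamental group of the circle is computed from the covering by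
the line. The complement of all pieces is star-shaped about the decreasing stack.

On the open subset `y_i < y_j` of the coordination space, the piece is given by `x_i - x_j = 0` and
`±(x_n - x_i) ≥ 0`, which are coordinates of a linear chart (`pieceChart`). Its tangent space is
the kernel of `x_i - x_j`, since any vector of this kernel becomes an inward one by adding a
multiple of a strictly inward vector. A point with `x_n = x_i` for some `n` between is a boundary
point, since `±(x_n - x_i)` has there a minimum on the piece but increases along an inward
half-line (`mem_hypersurfaceBoundary_of_linear_min`); at such a point the sign at `n` may be
reversed, so that it lies in another piece of the same pair.
-/

open Topology

/-! ### Fundamental groups -/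

section FundamentalGroups

open CategoryTheory
open scoped ContinuousMap unitInterval

/-- A homotopy equivalence is fully faithful on fundamental groupoids, hence an isomorphism on
vertex groups. -/
theorem ContinuousMap.HomotopyEquiv.nonempty_fundamentalGroup_mulEquiv {X Y : Type*}
    [TopologicalSpace X] [TopologicalSpace Y] (e : X ≃ₕ Y) (x : X) :
    ∃ y : Y, Nonempty (FundamentalGroup X x ≃* FundamentalGroup Y y) :=
  ⟨_, ⟨(FundamentalGroupoidFunctor.equivOfHomotopyEquiv e).fullyFaithfulFunctor.mulEquivEnd
    (FundamentalGroupoid.mk x)⟩⟩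

theorem ContinuousMap.HomotopyEquiv.pathConnectedSpace {X Y : Type*}
    [TopologicalSpace X] [TopologicalSpace Y] [PathConnectedSpace Y] (e : X ≃ₕ Y) :
    PathConnectedSpace X := by
  obtain ⟨H⟩ := e.left_inv
  refine ⟨⟨e.symm (Classical.arbitrary Y)⟩, fun a b ↦ ?_⟩
  have h (c : X) : Joined (e.symm (e c)) c := ⟨H.evalAt c⟩
  exact (h a).symm.trans
    (((PathConnectedSpace.joined (e a) (e b)).map e.symm.continuous).trans (h b))

theorem Circle.nonempty_fundamentalGroup_mulEquiv (x : Circle) :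
    Nonempty (FundamentalGroup Circle x ≃* Multiplicative ℤ) := by
  obtain ⟨t, rfl⟩ := Circle.isAddQuotientCoveringMap_exp.surjective x
  have hπ : (2 * Real.pi) ≠ 0 := by positivity
  let f : ℤ ≃+ AddSubgroup.zmultiples (2 * Real.pi) := AddEquiv.ofBijective
    ((zmultiplesHom ℝ (2 * Real.pi)).codRestrict (AddSubgroup.zmultiples (2 * Real.pi))
      fun n ↦ ⟨n, rfl⟩)
    ⟨fun m n h ↦ by
        have h' : m • (2 * Real.pi) = n • (2 * Real.pi) := congrArg Subtype.val h
        simpa [hπ] using h',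
      fun ⟨_, n, hn⟩ ↦ ⟨n, Subtype.ext hn⟩⟩
  exact ⟨(Circle.isAddQuotientCoveringMap_exp.fundamentalGroupEquiv ⟨t, rfl⟩).trans
    ((MulOpposite.opMulEquiv).symm.trans f.symm.toMultiplicative)⟩

/-- Two maps into a subset of a vector space are homotopic if the segments between
corresponding values stay in the subset. -/
theorem ContinuousMap.homotopic_of_segment_mem {X E : Type*} [TopologicalSpace X]
    [AddCommGroup E] [Module ℝ E] [TopologicalSpace E] [IsTopologicalAddGroup E]
    [ContinuousSMul ℝ E] {s : Set E} (f g : C(X, s))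
    (h : ∀ x, ∀ t : ℝ, 0 ≤ t → t ≤ 1 → (1 - t) • (f x : E) + t • (g x : E) ∈ s) :
    f.Homotopic g :=
  ⟨{ toFun := fun q ↦ ⟨(1 - (q.1 : ℝ)) • (f q.2 : E) + (q.1 : ℝ) • (g q.2 : E),
        h q.2 q.1 q.1.2.1 q.1.2.2⟩
     continuous_toFun := by fun_prop
     map_zero_left := by intro x; ext1; simp
     map_one_left := by intro x; ext1; simp }⟩

/-- The radial projection of the punctured plane to the unit circle. -/
noncomputable def unitDirection (z : {z : ℂ // z ≠ 0}) : Circle :=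
  ⟨(‖(z : ℂ)‖⁻¹ : ℝ) • (z : ℂ), by
    have := norm_ne_zero_iff.2 z.2
    simp [Submonoid.unitSphere, this]⟩

theorem continuous_unitDirection : Continuous unitDirection := by
  refine Continuous.subtype_mk ?_ _
  exact (continuous_subtype_val.norm.inv₀ fun z ↦ norm_ne_zero_iff.2 z.2).smul
    continuous_subtype_val

theorem unitDirection_coe_circle (v : Circle) : unitDirection ⟨v, v.coe_ne_zero⟩ = v := by
  ext; simp [unitDirection, v.norm_coe]

theorem re_unitDirection (z : {z : ℂ // z ≠ 0}) :
    (unitDirection z : ℂ).re = ‖(z : ℂ)‖⁻¹ * (z : ℂ).re := by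
  simp [unitDirection]

theorem im_unitDirection (z : {z : ℂ // z ≠ 0}) :
    (unitDirection z : ℂ).im = ‖(z : ℂ)‖⁻¹ * (z : ℂ).im := by
  simp [unitDirection]

end FundamentalGroups

/-! ### The pieces and their complements -/

/-- The sign of `x_n - x_i` prescribed on a piece: `-` stands for `x_i ≤ x_n`, so it becomes `1`. -/
def PieceSign.toReal : PieceSign → ℝ
  | minus => 1
  | plus => -1

theorem PieceSign.toReal_mul_self (s : PieceSign) : s.toReal * s.toReal = 1 := by
  cases s <;> simp [toReal]

theorem PieceSign.toReal_eq_neg_of_ne {s t : PieceSign} (h : s ≠ t) : s.toReal = -t.toReal := by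
  cases s <;> cases t <;> simp_all [toReal]

theorem PieceSign.exists_toReal_mul_nonneg (r : ℝ) : ∃ s : PieceSign, 0 ≤ s.toReal * r := by
  rcases le_total 0 r with h | h
  · exact ⟨minus, by simpa [toReal] using h⟩
  · exact ⟨plus, by simpa [toReal] using h⟩

theorem PieceSign.exists_toReal_eq_neg (s : PieceSign) : ∃ t : PieceSign, t.toReal = -s.toReal := by
  cases s
  · exact ⟨plus, by simp [toReal]⟩
  · exact ⟨minus, by simp [toReal]⟩

theorem SplitIndex.ne_of_σ {N : ℕ} {i j : Fin N} {h : i < j} {σ τ : Set.Ioo i j → PieceSign}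
    (hστ : σ ≠ τ) : (⟨i, j, h, σ⟩ : SplitIndex N) ≠ ⟨i, j, h, τ⟩ := by
  intro he
  cases he
  exact hστ rfl

theorem mem_splitHalfHyperplane_iff {N : ℕ} {α : SplitIndex N} {p : Config N} :
    p ∈ splitHalfHyperplane α ↔ p α.i 0 = p α.j 0 ∧ p α.i 1 < p α.j 1 ∧
      ∀ n : Set.Ioo α.i α.j, 0 ≤ (α.σ n).toReal * (p n 0 - p α.i 0) := by
  refine and_congr_right fun _ ↦ and_congr_right fun _ ↦ forall_congr' fun n ↦ ?_
  cases α.σ n <;> simp [PieceSign.toReal]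

theorem mem_coordinationSpace_iff {N : ℕ} {p : Config N} :
    p ∈ coordinationSpace N ↔ ∀ i j, i < j → p i 0 = p j 0 → p i 1 ≠ p j 1 := by
  simp only [coordinationSpace, collisionSet, Set.mem_sdiff, Set.mem_univ, true_and,
    Set.mem_iUnion, not_exists, Set.mem_ofPred_eq, not_and, ne_eq]

/-- The half-hyperplanes with a given pair of indices cover the set `x_i = x_j`, `y_i < y_j`. -/
theorem exists_mem_splitHalfHyperplane {N : ℕ} {p : Config N} {i j : Fin N} (hij : i < j)
    (hx : p i 0 = p j 0) (hy : p i 1 < p j 1) :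
    ∃ σ, p ∈ splitHalfHyperplane ⟨i, j, hij, σ⟩ := by
  choose s hs using PieceSign.exists_toReal_mul_nonneg
  exact ⟨fun n ↦ s (p n 0 - p i 0), mem_splitHalfHyperplane_iff.2 ⟨hx, hy, fun n ↦ hs _⟩⟩

/-- At a point where `x_n`, for some `n` between `i` and `j`, is not strictly on the side of `x_i`
prescribed by `σ_n`, the sign at `n` can be reversed. -/
theorem exists_ne_mem_splitHalfHyperplane {N : ℕ} {p : Config N} {α : SplitIndex N}
    (hx : p α.i 0 = p α.j 0) (hy : p α.i 1 < p α.j 1) (n : Set.Ioo α.i α.j)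
    (hn : (α.σ n).toReal * (p n 0 - p α.i 0) ≤ 0) :
    ∃ β ≠ α, p ∈ splitHalfHyperplane β := by
  obtain ⟨τ, hτ⟩ := exists_mem_splitHalfHyperplane α.lt hx hy
  obtain ⟨t, ht⟩ := PieceSign.exists_toReal_eq_neg (α.σ n)
  classical
  refine ⟨⟨α.i, α.j, α.lt, Function.update τ n t⟩, SplitIndex.ne_of_σ fun h ↦ ?_,
    mem_splitHalfHyperplane_iff.2 ⟨hx, hy, fun m ↦ ?_⟩⟩
  · have h' := congrFun h n
    rw [Function.update_self] at h'
    have := (α.σ n).toReal_mul_self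
    rw [← h'] at ht this
    nlinarith
  · rcases eq_or_ne n m with rfl | hm
    · simp only [Function.update_self, ht]
      linarith
    · simp only [Function.update_of_ne hm.symm]
      exact (mem_splitHalfHyperplane_iff.1 hτ).2.2 m

theorem mem_compl_pieces_iff {N : ℕ} {p : Config N} :
    p ∈ coordinationSpace N \ ⋃ α : SplitIndex N, splitHalfHyperplane α ↔
      ∀ i j, i < j → p i 0 = p j 0 → p j 1 < p i 1 := by
  simp only [Set.mem_sdiff, Set.mem_iUnion, not_exists, mem_coordinationSpace_iff]
  constructor
  · rintro ⟨hX, hU⟩ i j hij hx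
    refine lt_of_le_of_ne (not_lt.1 fun hy ↦ ?_) (hX i j hij hx).symm
    obtain ⟨σ, hσ⟩ := exists_mem_splitHalfHyperplane hij hx hy
    exact hU _ hσ
  · intro h
    refine ⟨fun i j hij hx ↦ (h i j hij hx).ne', fun α hα ↦ ?_⟩
    rw [mem_splitHalfHyperplane_iff] at hα
    exact lt_asymm hα.2.1 (h _ _ α.lt hα.1)

theorem mem_singlePieceSpace_iff {N : ℕ} {α : SplitIndex N} {p : Config N} :
    p ∈ singlePieceSpace α ↔
      (∀ k l, k < l → (k, l) ≠ (α.i, α.j) → p k 0 = p l 0 → p l 1 < p k 1) ∧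
      (p α.i 0 = p α.j 0 → p α.j 1 < p α.i 1 ∨ p α.i 1 < p α.j 1 ∧
        ∀ n : Set.Ioo α.i α.j, 0 < (α.σ n).toReal * (p n 0 - p α.i 0)) := by
  simp only [singlePieceSpace, Set.mem_sdiff, Set.mem_iUnion, not_exists, mem_coordinationSpace_iff]
  constructor
  · rintro ⟨hX, hU⟩
    refine ⟨fun k l hkl hne hx ↦ ?_, fun hx ↦ ?_⟩
    · refine lt_of_le_of_ne (not_lt.1 fun hy ↦ ?_) (hX k l hkl hx).symm
      obtain ⟨σ, hσ⟩ := exists_mem_splitHalfHyperplane hkl hx hy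
      exact hU _ (by rintro rfl; exact hne rfl) hσ
    · refine (hX _ _ α.lt hx).lt_or_gt.symm.imp id fun hy ↦ ⟨hy, fun n ↦ ?_⟩
      by_contra! hn
      obtain ⟨β, hβ, hp⟩ := exists_ne_mem_splitHalfHyperplane hx hy n hn
      exact hU β hβ hp
  · rintro ⟨h, h'⟩
    have hX (i j : Fin N) (hij : i < j) (hx : p i 0 = p j 0) : p i 1 ≠ p j 1 := by
      by_cases he : (i, j) = (α.i, α.j)
      · obtain ⟨rfl, rfl⟩ := Prod.mk.inj he
        exact (h' hx).elim (·.ne') (·.1.ne)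
      · exact (h i j hij he hx).ne'
    refine ⟨hX, fun β hβ hp ↦ ?_⟩
    rw [mem_splitHalfHyperplane_iff] at hp
    obtain ⟨k, l, hkl, τ⟩ := β
    obtain ⟨i, j, hij, σ⟩ := α
    by_cases he : (k, l) = (i, j)
    · obtain ⟨rfl, rfl⟩ := Prod.mk.inj he
      have hτ : τ ≠ σ := by rintro rfl; exact hβ rfl
      obtain ⟨n, hn⟩ := Function.ne_iff.1 hτ
      have h1 := hp.2.2 n
      rcases h' hp.1 with h2 | h2
      · exact lt_asymm h2 hp.2.1
      · have h3 := h2.2 n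
        simp only [PieceSign.toReal_eq_neg_of_ne hn] at h1 h3
        linarith
    · exact lt_asymm hp.2.1 (h k l hkl he hp.1)

/-- The complement of all pieces is star-shaped about a vertical stack of robots in decreasing
order. -/
theorem simplyConnectedSpace_compl_pieces (N : ℕ) : SimplyConnectedSpace
    ↥(coordinationSpace N \ ⋃ α : SplitIndex N, splitHalfHyperplane α) := by
  have h0 : (fun k ↦ !₂[0, -((k : ℕ) : ℝ)] : Config N) ∈
      coordinationSpace N \ ⋃ α : SplitIndex N, splitHalfHyperplane α := by
    rw [mem_compl_pieces_iff]
    intro i j hij _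
    simpa using hij
  have hs : StarConvex ℝ (fun k ↦ !₂[0, -((k : ℕ) : ℝ)] : Config N)
      (coordinationSpace N \ ⋃ α : SplitIndex N, splitHalfHyperplane α) := by
    intro p hp a b ha hb hab
    rw [mem_compl_pieces_iff] at hp ⊢
    intro i j hij hx
    have hij' : ((i : ℕ) : ℝ) < ((j : ℕ) : ℝ) := by exact_mod_cast hij
    simp only [Pi.add_apply, Pi.smul_apply, PiLp.add_apply, PiLp.smul_apply, smul_eq_mul,
      Matrix.cons_val_zero, Matrix.cons_val_one, mul_zero, zero_add] at hx ⊢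
    rcases hb.eq_or_lt with rfl | hb
    · obtain rfl : a = 1 := by linarith
      simpa using hij
    · have := hp i j hij (mul_left_cancel₀ hb.ne' hx)
      nlinarith
  have := hs.contractibleSpace ⟨_, h0⟩
  infer_instance

/-! ### The space with a single piece -/

section SinglePiece

variable {N : ℕ} (α : SplitIndex N)

/-- The configuration with given first and second coordinates. -/
noncomputable def mkConfig (x y : Fin N → ℝ) : Config N := fun k ↦ !₂[x k, y k]

@[simp] theorem mkConfig_apply_zero (x y : Fin N → ℝ) (k : Fin N) : mkConfig x y k 0 = x k := rfl

@[simp] theorem mkConfig_apply_one (x y : Fin N → ℝ) (k : Fin N) : mkConfig x y k 1 = y k := rfl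

@[fun_prop]
theorem Continuous.mkConfig {X : Type*} [TopologicalSpace X] {x y : X → Fin N → ℝ}
    (hx : Continuous x) (hy : Continuous y) : Continuous fun z ↦ mkConfig (x z) (y z) := by
  refine continuous_pi fun k ↦ (PiLp.continuous_toLp 2 _).comp (continuous_pi fun a ↦ ?_)
  fin_cases a
  · exact (continuous_apply k).comp hx
  · exact (continuous_apply k).comp hy

/-- The first coordinates of the model loop: robots `i` and `j` are at `-a` and `a`, the robots
between them lie on the side given by `σ`, clear of `[-1, 1]`. -/
noncomputable def modelX (a : ℝ) (k : Fin N) : ℝ :=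
  if k = α.i then -a else if k = α.j then a else
    if h : k ∈ Set.Ioo α.i α.j then 2 * (α.σ ⟨k, h⟩).toReal else 0

/-- The second coordinates of the model loop: the decreasing stack `-k` in which robots `i` and
`j` exchange their places as `φ` runs from `0` to `1`. -/
noncomputable def modelY (φ : ℝ) (k : Fin N) : ℝ :=
  if k = α.i then -((α.i : ℕ) : ℝ) - φ * ((α.j : ℕ) - (α.i : ℕ)) else
    if k = α.j then -((α.j : ℕ) : ℝ) + φ * ((α.j : ℕ) - (α.i : ℕ)) else -((k : ℕ) : ℝ)

/-- First coordinates `x` that are compatible with the partial exchange `modelY α φ`. -/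
structure IsCompatible (x : Fin N → ℝ) (φ : ℝ) : Prop where
  nonneg : 0 ≤ φ
  le_one : φ ≤ 1
  sign_i : φ ≠ 0 → ∀ n : Set.Ioo α.i α.j, 0 < (α.σ n).toReal * (x n - x α.i)
  sign_j : φ ≠ 0 → ∀ n : Set.Ioo α.i α.j, 0 < (α.σ n).toReal * (x n - x α.j)
  extreme : x α.i = x α.j → φ = 0 ∨ φ = 1

variable {α}

theorem modelX_i (a : ℝ) : modelX α a α.i = -a := by simp [modelX]

theorem modelX_j (a : ℝ) : modelX α a α.j = a := by simp [modelX, α.lt.ne']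

theorem modelX_between (a : ℝ) (n : Set.Ioo α.i α.j) :
    modelX α a n = 2 * (α.σ n).toReal := by
  have h := n.2
  simp [modelX, h.1.ne', h.2.ne]

theorem modelY_i (φ : ℝ) :
    modelY α φ α.i = -((α.i : ℕ) : ℝ) - φ * ((α.j : ℕ) - (α.i : ℕ)) := by simp [modelY]

theorem modelY_j (φ : ℝ) :
    modelY α φ α.j = -((α.j : ℕ) : ℝ) + φ * ((α.j : ℕ) - (α.i : ℕ)) := by
  simp [modelY, α.lt.ne']

theorem SplitIndex.cast_lt : ((α.i : ℕ) : ℝ) < ((α.j : ℕ) : ℝ) := by exact_mod_cast α.lt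

/-- Only robots `i`, `j` and those between them can be in the wrong order under `modelY`. -/
theorem modelY_lt {x : Fin N → ℝ} {φ : ℝ} (h : IsCompatible α x φ) {k l : Fin N} (hkl : k < l)
    (hne : (k, l) ≠ (α.i, α.j)) (hx : x k = x l) : modelY α φ l < modelY α φ k := by
  have hij := α.cast_lt
  have h0 := h.nonneg
  have h1 := h.le_one
  have hc : ((k : ℕ) : ℝ) < ((l : ℕ) : ℝ) := by exact_mod_cast hkl
  have e1 : φ * ((α.j : ℕ) - (α.i : ℕ) : ℝ) ≤ (α.j : ℕ) - (α.i : ℕ) := by nlinarith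
  have e0 : 0 ≤ φ * ((α.j : ℕ) - (α.i : ℕ) : ℝ) := by nlinarith
  by_cases hφ : φ = 0
  · subst hφ
    unfold modelY
    split_ifs <;> subst_vars <;> linarith
  by_cases hki : k = α.i
  · subst hki
    have hlj : l ≠ α.j := by rintro rfl; exact hne rfl
    by_cases hl : l < α.j
    · have := h.sign_i hφ ⟨l, hkl, hl⟩
      simp [hx] at this
    · have hc' : ((α.j : ℕ) : ℝ) < ((l : ℕ) : ℝ) := by
        exact_mod_cast lt_of_le_of_ne (not_lt.1 hl) hlj.symm
      simp only [modelY, hkl.ne', hlj, if_true, if_false]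
      linarith
  by_cases hlj : l = α.j
  · subst hlj
    by_cases hk : α.i < k
    · have := h.sign_j hφ ⟨k, hk, hkl⟩
      simp [hx] at this
    · have hc' : ((k : ℕ) : ℝ) < ((α.i : ℕ) : ℝ) := by
        exact_mod_cast lt_of_le_of_ne (not_lt.1 hk) hki
      simp only [modelY, hkl.ne, hki, α.lt.ne', if_true, if_false]
      linarith
  unfold modelY
  split_ifs <;> subst_vars <;> linarith

theorem mkConfig_modelY_mem {x : Fin N → ℝ} {φ : ℝ} (h : IsCompatible α x φ) :
    mkConfig x (modelY α φ) ∈ singlePieceSpace α := by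
  have hij := α.cast_lt
  refine mem_singlePieceSpace_iff.2 ⟨fun k l hkl hne hx ↦ modelY_lt h hkl hne hx, fun hx ↦ ?_⟩
  simp only [mkConfig_apply_zero, mkConfig_apply_one, modelY_i, modelY_j] at hx ⊢
  rcases h.extreme hx with rfl | rfl
  · left; linarith
  · exact Or.inr ⟨by linarith, h.sign_i one_ne_zero⟩

theorem isCompatible_modelX {a φ : ℝ} (ha : |a| ≤ 1) (h0 : 0 ≤ φ) (h1 : φ ≤ 1)
    (h : a = 0 → φ = 0 ∨ φ = 1) : IsCompatible α (modelX α a) φ where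
  nonneg := h0
  le_one := h1
  sign_i _ n := by
    rw [modelX_between, modelX_i]
    rw [abs_le] at ha
    cases α.σ n <;> simp only [PieceSign.toReal] <;> linarith
  sign_j _ n := by
    rw [modelX_between, modelX_j]
    rw [abs_le] at ha
    cases α.σ n <;> simp only [PieceSign.toReal] <;> linarith
  extreme hx := h (by rw [modelX_i, modelX_j] at hx; linarith)

variable (α) in
/-- A function that is positive exactly where robot `j` is above robot `i` and all robots between
them are strictly on the sides given by `σ` of both. -/
noncomputable def pieceWeight (p : Config N) : ℝ :=
  max 0 (p α.j 1 - p α.i 1) * ∏ n : Set.Ioo α.i α.j,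
    max 0 ((α.σ n).toReal * (p n 0 - p α.i 0)) * max 0 ((α.σ n).toReal * (p n 0 - p α.j 0))

theorem pieceWeight_nonneg (p : Config N) : 0 ≤ pieceWeight α p :=
  mul_nonneg (le_max_left _ _) (Finset.prod_nonneg fun _ _ ↦
    mul_nonneg (le_max_left _ _) (le_max_left _ _))

variable (α) in
/-- The denominator of `exchangeRatio`. -/
noncomputable def pieceDenominator (p : Config N) : ℝ :=
  pieceWeight α p + (|p α.j 0 - p α.i 0| + max 0 (p α.i 1 - p α.j 1))

variable (α) in
/-- A continuous function with values in `[0, 1]`, equal to `1` exactly on the piece and to `0`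
where the order of the robots does not allow an exchange of robots `i` and `j`. -/
noncomputable def exchangeRatio (p : Config N) : ℝ := pieceWeight α p / pieceDenominator α p

theorem pieceWeight_pos {p : Config N} (hx : p α.i 0 = p α.j 0) (hy : p α.i 1 < p α.j 1)
    (h : ∀ n : Set.Ioo α.i α.j, 0 < (α.σ n).toReal * (p n 0 - p α.i 0)) :
    0 < pieceWeight α p := by
  refine mul_pos (lt_max_of_lt_right (sub_pos.2 hy)) (Finset.prod_pos fun n _ ↦ ?_)
  have := lt_max_of_lt_right (b := (0 : ℝ)) (h n)
  rw [← hx]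
  exact mul_pos this this

theorem pieceDenominator_pos {p : Config N} (hp : p ∈ singlePieceSpace α) :
    0 < pieceDenominator α p := by
  have hw := pieceWeight_nonneg (α := α) p
  have hm := le_max_left 0 (p α.i 1 - p α.j 1)
  have ha := abs_nonneg (p α.j 0 - p α.i 0)
  unfold pieceDenominator
  by_cases hx : p α.i 0 = p α.j 0
  · rcases (mem_singlePieceSpace_iff.1 hp).2 hx with h | h
    · have := lt_max_of_lt_right (b := (0 : ℝ)) (sub_pos.2 h)
      linarith
    · have := pieceWeight_pos hx h.1 h.2
      linarith
  · have : 0 < |p α.j 0 - p α.i 0| := abs_pos.2 (sub_ne_zero.2 (Ne.symm hx))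
    linarith

theorem exchangeRatio_eq_zero {p : Config N} (hy : p α.j 1 < p α.i 1) :
    exchangeRatio α p = 0 := by
  simp [exchangeRatio, pieceWeight, max_eq_left (sub_nonpos.2 hy.le)]

theorem exchangeRatio_eq_one {p : Config N} (hx : p α.i 0 = p α.j 0) (hy : p α.i 1 < p α.j 1)
    (h : ∀ n : Set.Ioo α.i α.j, 0 < (α.σ n).toReal * (p n 0 - p α.i 0)) :
    exchangeRatio α p = 1 := by
  have := pieceWeight_pos hx hy h
  rw [exchangeRatio, pieceDenominator, hx, sub_self, abs_zero,
    max_eq_left (sub_nonpos.2 hy.le), add_zero, add_zero, div_self this.ne']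

theorem isCompatible_exchangeRatio {p : Config N} (hp : p ∈ singlePieceSpace α) :
    IsCompatible α (fun k ↦ p k 0) (exchangeRatio α p) := by
  have hw := pieceWeight_nonneg (α := α) p
  have hd := pieceDenominator_pos hp
  have key (h : exchangeRatio α p ≠ 0) (n : Set.Ioo α.i α.j) :
      max 0 ((α.σ n).toReal * (p n 0 - p α.i 0)) ≠ 0 ∧
        max 0 ((α.σ n).toReal * (p n 0 - p α.j 0)) ≠ 0 := by
    have h1 : pieceWeight α p ≠ 0 := fun h0 ↦ h (by simp [exchangeRatio, h0])
    exact mul_ne_zero_iff.1 (Finset.prod_ne_zero_iff.1 (right_ne_zero_of_mul h1) n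
      (Finset.mem_univ n))
  have pos {r : ℝ} (h : max 0 r ≠ 0) : 0 < r := by
    by_contra! hr
    exact h (max_eq_left hr)
  refine ⟨div_nonneg hw hd.le, div_le_one_of_le₀ ?_ hd.le, fun h n ↦ pos (key h n).1,
    fun h n ↦ pos (key h n).2, fun hx ↦ ?_⟩
  · exact le_add_of_nonneg_right (add_nonneg (abs_nonneg _) (le_max_left _ _))
  · exact ((mem_singlePieceSpace_iff.1 hp).2 hx).imp exchangeRatio_eq_zero
      fun h ↦ exchangeRatio_eq_one hx h.1 h.2

@[fun_prop]
theorem continuous_exchangeRatio :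
    Continuous fun p : singlePieceSpace α ↦ exchangeRatio α (p : Config N) := by
  have hw : Continuous (pieceWeight α) := by
    unfold pieceWeight
    fun_prop
  have hd : Continuous (pieceDenominator α) := by
    unfold pieceDenominator
    fun_prop
  exact (hw.comp continuous_subtype_val).div (hd.comp continuous_subtype_val)
    fun p ↦ (pieceDenominator_pos p.2).ne'

variable (α) in
/-- The map to the plane whose winding about the origin counts crossings of the piece. -/
noncomputable def windingVector (p : Config N) : ℂ :=
  ⟨p α.j 0 - p α.i 0, 2 * exchangeRatio α p - 1⟩

theorem windingVector_ne_zero {p : Config N} (hp : p ∈ singlePieceSpace α) :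
    windingVector α p ≠ 0 := by
  intro h
  have h1 := congrArg Complex.re h
  have h2 := congrArg Complex.im h
  simp only [windingVector, Complex.zero_re, Complex.zero_im] at h1 h2
  rcases (isCompatible_exchangeRatio hp).extreme (by linarith) with h3 | h3 <;>
    rw [h3] at h2 <;> norm_num at h2

theorem continuous_windingVector :
    Continuous fun p : singlePieceSpace α ↦ windingVector α (p : Config N) := by
  have h : Continuous fun p : Config N ↦ p α.j 0 - p α.i 0 := by fun_prop
  exact Complex.equivRealProdCLM.symm.continuous.comp
    ((h.comp continuous_subtype_val).prodMk
      ((continuous_exchangeRatio.const_mul 2).sub continuous_const))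

variable (α) in
/-- The direction of `windingVector`. -/
noncomputable def windingMap : C(singlePieceSpace α, Circle) where
  toFun p := unitDirection ⟨windingVector α p, windingVector_ne_zero p.2⟩
  continuous_toFun := continuous_unitDirection.comp (continuous_windingVector.subtype_mk _)

theorem circle_sq_add_sq (v : Circle) : (v : ℂ).re ^ 2 + (v : ℂ).im ^ 2 = 1 := by
  have := v.normSq_coe
  rw [Complex.normSq_apply] at this
  linarith

theorem isCompatible_circle (v : Circle) :
    IsCompatible α (modelX α (v : ℂ).re) ((1 + (v : ℂ).im) / 2) := by
  have h := circle_sq_add_sq v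
  refine isCompatible_modelX (abs_le_one_iff_mul_self_le_one.2 (by nlinarith)) (by nlinarith)
    (by nlinarith) fun h0 ↦ ?_
  rw [h0] at h
  have : (v : ℂ).im = 1 ∨ (v : ℂ).im = -1 := 
    sq_eq_sq_iff_eq_or_eq_neg.1 (by linarith)
  rcases this with h | h <;> rw [h] <;> norm_num

theorem continuous_modelX : Continuous (modelX α) := by
  refine continuous_pi fun k ↦ ?_
  unfold modelX
  split_ifs <;> fun_prop

theorem continuous_modelY : Continuous (modelY α) := by
  refine continuous_pi fun k ↦ ?_
  unfold modelY
  split_ifs <;> fun_prop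

variable (α) in
/-- The loop around which `singlePieceSpace α` contracts. -/
noncomputable def modelLoop : C(Circle, singlePieceSpace α) where
  toFun v := ⟨mkConfig (modelX α (v : ℂ).re) (modelY α ((1 + (v : ℂ).im) / 2)),
    mkConfig_modelY_mem (isCompatible_circle v)⟩
  continuous_toFun := by
    have hX := continuous_modelX (α := α)
    have hY := continuous_modelY (α := α)
    have hre : Continuous fun v : Circle ↦ (v : ℂ).re :=
      Complex.continuous_re.comp continuous_subtype_val
    have him : Continuous fun v : Circle ↦ (v : ℂ).im :=
      Complex.continuous_im.comp continuous_subtype_val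
    exact Continuous.subtype_mk ((hX.comp hre).mkConfig
      (hY.comp ((continuous_const.add him).div_const 2))) _

/-- Comparing the exchange ratio with the direction of the winding vector: both agree where
robots `i` and `j` are on a vertical line. -/
theorem windingMap_of_eq {p : singlePieceSpace α}
    (h : ((windingMap α p : Circle) : ℂ).re = 0) :
    (p : Config N) α.i 0 = (p : Config N) α.j 0 ∧
      (1 + ((windingMap α p : Circle) : ℂ).im) / 2 = exchangeRatio α (p : Config N) := by
  have hz := windingVector_ne_zero p.2
  have hn : ‖windingVector α (p : Config N)‖⁻¹ ≠ 0 := inv_ne_zero (norm_ne_zero_iff.2 hz)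
  have h1 := circle_sq_add_sq (windingMap α p)
  have hre := re_unitDirection ⟨_, hz⟩
  have him := im_unitDirection ⟨_, hz⟩
  change ((windingMap α p : Circle) : ℂ).re = _ at hre
  change ((windingMap α p : Circle) : ℂ).im = _ at him
  rw [h] at hre h1
  have hx : (p : Config N) α.i 0 = (p : Config N) α.j 0 := by
    have : (p : Config N) α.j 0 - (p : Config N) α.i 0 = 0 :=
      (mul_eq_zero.1 hre.symm).resolve_left hn
    linarith
  refine ⟨hx, ?_⟩
  have hpos : 0 < ‖windingVector α (p : Config N)‖⁻¹ := inv_pos.2 (norm_pos_iff.2 hz)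
  have h2 : ((windingMap α p : Circle) : ℂ).im = 1 ∨
      ((windingMap α p : Circle) : ℂ).im = -1 :=
    sq_eq_sq_iff_eq_or_eq_neg.1 (by linarith)
  simp only [windingVector] at him hpos
  rcases (isCompatible_exchangeRatio p.2).extreme hx with h3 | h3 <;> rw [h3] at him ⊢ hpos <;>
    rcases h2 with h2 | h2 <;> rw [h2] at him ⊢ <;> linarith

/-- On the model loop, the winding vector lies in the same open half-plane as the parameter. -/
theorem windingVector_modelLoop (v : Circle) (t : ℝ) (_ : 0 ≤ t) (h1 : t ≤ 1) :
    (1 - t) • windingVector α (modelLoop α v : Config N) + t • (v : ℂ) ≠ 0 := by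
  intro h
  have hre := congrArg Complex.re h
  have him := congrArg Complex.im h
  have hv := circle_sq_add_sq v
  have hij := α.cast_lt
  simp only [windingVector, modelLoop, ContinuousMap.coe_mk, mkConfig_apply_zero, modelX_i,
    modelX_j, Complex.add_re, Complex.smul_re, Complex.add_im, Complex.smul_im, smul_eq_mul,
    Complex.zero_re, Complex.zero_im] at hre him
  have hr : (v : ℂ).re = 0 := by
    have : (2 - t) * (v : ℂ).re = 0 := by linarith
    exact (mul_eq_zero.1 this).resolve_left (by linarith)
  rw [hr] at him hv
  have h2 : (v : ℂ).im = 1 ∨ (v : ℂ).im = -1 := sq_eq_sq_iff_eq_or_eq_neg.1 (by linarith)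
  rcases h2 with h2 | h2 <;> rw [h2] at him
  · rw [exchangeRatio_eq_one] at him
    · linarith
    · simp [modelX_i, modelX_j]
    · simp only [mkConfig_apply_one, modelY_i, modelY_j]; linarith
    · intro n
      have := (α.σ n).toReal_mul_self
      simp only [mkConfig_apply_zero, modelX_i, modelX_between]
      linarith
  · rw [exchangeRatio_eq_zero] at him
    · linarith
    · simp only [mkConfig_apply_one, modelY_i, modelY_j]; linarith

theorem windingMap_comp_modelLoop_homotopic :
    ((windingMap α).comp (modelLoop α)).Homotopic (ContinuousMap.id Circle) := by
  let f : C(Circle, {z : ℂ | z ≠ 0}) :=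
    ⟨fun v ↦ ⟨windingVector α (modelLoop α v : Config N), windingVector_ne_zero (modelLoop α v).2⟩,
      (continuous_windingVector.comp (modelLoop α).continuous).subtype_mk _⟩
  let g : C(Circle, {z : ℂ | z ≠ 0}) := ⟨fun v ↦ ⟨v, v.coe_ne_zero⟩,
    continuous_subtype_val.subtype_mk _⟩
  have h := (ContinuousMap.homotopic_of_segment_mem f g windingVector_modelLoop)
  have h' := (ContinuousMap.Homotopic.refl
    (⟨unitDirection, continuous_unitDirection⟩ : C({z : ℂ // z ≠ 0}, Circle))).comp h
  convert h' using 1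
  · rfl
  · exact ContinuousMap.ext fun v ↦ (unitDirection_coe_circle v).symm

theorem segment_mkConfig (x y x' y' : Fin N → ℝ) (t : ℝ) :
    (1 - t) • mkConfig x y + t • mkConfig x' y' =
      mkConfig ((1 - t) • x + t • x') ((1 - t) • y + t • y') := by
  ext k a
  fin_cases a <;> simp [mkConfig]

theorem modelY_segment (φ ψ t : ℝ) :
    (1 - t) • modelY α φ + t • modelY α ψ = modelY α ((1 - t) * φ + t * ψ) := by
  ext k
  simp only [modelY, Pi.add_apply, Pi.smul_apply, smul_eq_mul]
  split_ifs <;> ring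

/-- Compatibility persists along a segment of first coordinates if the order of `x_i` and `x_j` is
the same at both ends. -/
theorem IsCompatible.segment {x x' : Fin N → ℝ} {φ c t : ℝ} (h : IsCompatible α x φ)
    (h' : IsCompatible α x' φ) (hc : 0 < c) (hcx : x' α.j - x' α.i = c * (x α.j - x α.i))
    (h0 : 0 ≤ t) (h1 : t ≤ 1) : IsCompatible α ((1 - t) • x + t • x') φ where
  nonneg := h.nonneg
  le_one := h.le_one
  sign_i hφ n := by
    have e := h.sign_i hφ n
    have e' := h'.sign_i hφ n
    simp only [Pi.add_apply, Pi.smul_apply, smul_eq_mul]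
    rcases h0.eq_or_lt with rfl | h0 <;> nlinarith
  sign_j hφ n := by
    have e := h.sign_j hφ n
    have e' := h'.sign_j hφ n
    simp only [Pi.add_apply, Pi.smul_apply, smul_eq_mul]
    rcases h0.eq_or_lt with rfl | h0 <;> nlinarith
  extreme hx := by
    simp only [Pi.add_apply, Pi.smul_apply, smul_eq_mul] at hx
    have h2 : (1 - t + t * c) * (x α.j - x α.i) = 0 := by
      linear_combination -hx - t * hcx
    have h3 : 0 < 1 - t + t * c := by
      rcases h0.eq_or_lt with rfl | h0
      · simp
      · have := mul_pos h0 hc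
        linarith
    exact h.extreme (by linarith [(mul_eq_zero.1 h2).resolve_left h3.ne'])

theorem segment_exchange_mem {p : Config N} (hp : p ∈ singlePieceSpace α) {t : ℝ}
    (h0 : 0 ≤ t) (h1 : t ≤ 1) : (1 - t) • p +
      t • mkConfig (fun k ↦ p k 0) (modelY α (exchangeRatio α p)) ∈ singlePieceSpace α := by
  have hc := isCompatible_exchangeRatio hp
  obtain ⟨a, b⟩ := mem_singlePieceSpace_iff.1 hp
  have a' (k l) (hkl) (hne) (hx) := modelY_lt hc (k := k) (l := l) hkl hne hx
  have aux {r s r' s' : ℝ} (h : r < s) (h' : r' < s') :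
      (1 - t) * r + t * r' < (1 - t) * s + t * s' := by
    rcases h0.eq_or_lt with rfl | h0
    · simpa using h
    · nlinarith
  have hx (k : Fin N) : ((1 - t) • p +
      t • mkConfig (fun k ↦ p k 0) (modelY α (exchangeRatio α p))) k 0 = p k 0 := by
    simp; ring
  have hy (k : Fin N) : ((1 - t) • p +
      t • mkConfig (fun k ↦ p k 0) (modelY α (exchangeRatio α p))) k 1 =
        (1 - t) * p k 1 + t * modelY α (exchangeRatio α p) k := by simp
  have hij := α.cast_lt
  refine mem_singlePieceSpace_iff.2 ⟨fun k l hkl hne hkx ↦ ?_, fun hkx ↦ ?_⟩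
  · rw [hx, hx] at hkx
    rw [hy, hy]
    exact aux (a k l hkl hne hkx) (a' k l hkl hne hkx)
  · simp only [hx] at hkx ⊢
    rw [hy, hy]
    rcases b hkx with h | h
    · refine Or.inl (aux h ?_)
      rw [exchangeRatio_eq_zero h, modelY_i, modelY_j]
      linarith
    · refine Or.inr ⟨aux h.1 ?_, h.2⟩
      rw [exchangeRatio_eq_one hkx h.1 h.2, modelY_i, modelY_j]
      linarith

/-- First the second coordinates are moved to their model position, then the first ones; last the
exchange ratio is adjusted. -/
theorem modelLoop_comp_windingMap_homotopic :
    ((modelLoop α).comp (windingMap α)).Homotopic (ContinuousMap.id (singlePieceSpace α)) := by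
  have hX := continuous_modelX (α := α)
  have hY := continuous_modelY (α := α)
  have hre : Continuous fun p : singlePieceSpace α ↦ ((windingMap α p : Circle) : ℂ).re :=
    Complex.continuous_re.comp (continuous_subtype_val.comp (windingMap α).continuous)
  have habs (p : singlePieceSpace α) : |((windingMap α p : Circle) : ℂ).re| ≤ 1 := by
    have := circle_sq_add_sq (windingMap α p)
    exact abs_le_one_iff_mul_self_le_one.2 (by nlinarith)
  have hφ := continuous_exchangeRatio (α := α)
  have hc (p : singlePieceSpace α) := isCompatible_exchangeRatio p.2
  have hx : Continuous fun (p : singlePieceSpace α) (k : Fin N) ↦ (p : Config N) k 0 := by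
    have h : Continuous fun (p : Config N) (k : Fin N) ↦ p k 0 := by fun_prop
    exact h.comp continuous_subtype_val
  have hc' (p : singlePieceSpace α) : IsCompatible α
      (modelX α ((windingMap α p : Circle) : ℂ).re) (exchangeRatio α (p : Config N)) :=
    isCompatible_modelX (habs p) (hc p).nonneg (hc p).le_one
      fun h ↦ (hc p).extreme (windingMap_of_eq h).1
  let f₁ : C(singlePieceSpace α, singlePieceSpace α) :=
    ⟨fun p ↦ ⟨mkConfig (fun k ↦ (p : Config N) k 0) (modelY α (exchangeRatio α (p : Config N))),
      mkConfig_modelY_mem (hc p)⟩, (hx.mkConfig (hY.comp hφ)).subtype_mk _⟩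
  let f₂ : C(singlePieceSpace α, singlePieceSpace α) :=
    ⟨fun p ↦ ⟨mkConfig (modelX α ((windingMap α p : Circle) : ℂ).re)
      (modelY α (exchangeRatio α (p : Config N))),
      mkConfig_modelY_mem (hc' p)⟩, ((hX.comp hre).mkConfig (hY.comp hφ)).subtype_mk _⟩
  have h₁ : (ContinuousMap.id (singlePieceSpace α)).Homotopic f₁ :=
    ContinuousMap.homotopic_of_segment_mem _ _ fun p t h0 h1 ↦ segment_exchange_mem p.2 h0 h1
  have h₂ : f₁.Homotopic f₂ := by
    refine ContinuousMap.homotopic_of_segment_mem _ _ fun p t h0 h1 ↦ ?_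
    change (1 - t) • mkConfig _ _ + t • mkConfig _ _ ∈ _
    rw [segment_mkConfig, ← add_smul, sub_add_cancel, one_smul]
    have hn : 0 < ‖windingVector α (p : Config N)‖⁻¹ :=
      inv_pos.2 (norm_pos_iff.2 (windingVector_ne_zero p.2))
    refine mkConfig_modelY_mem ((hc p).segment (hc' p) (mul_pos two_pos hn) ?_ h0 h1)
    have he : ((windingMap α p : Circle) : ℂ).re = ‖windingVector α (p : Config N)‖⁻¹ *
        ((p : Config N) α.j 0 - (p : Config N) α.i 0) :=
      re_unitDirection ⟨_, windingVector_ne_zero p.2⟩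
    rw [modelX_i, modelX_j, he]
    ring
  have h₃ : f₂.Homotopic ((modelLoop α).comp (windingMap α)) := by
    refine ContinuousMap.homotopic_of_segment_mem _ _ fun p t h0 h1 ↦ ?_
    change (1 - t) • mkConfig _ _ + t • mkConfig _ _ ∈ _
    rw [segment_mkConfig, ← add_smul, sub_add_cancel, one_smul, modelY_segment]
    have := isCompatible_circle (α := α) (windingMap α p)
    refine mkConfig_modelY_mem (isCompatible_modelX (habs p) ?_ ?_ fun h ↦ ?_)
    · have := this.nonneg
      have := (hc p).nonneg
      nlinarith
    · have := this.le_one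
      have := (hc p).le_one
      nlinarith
    · rw [(windingMap_of_eq h).2, ← add_mul, sub_add_cancel, one_mul]
      exact (hc p).extreme (windingMap_of_eq h).1
  exact (h₁.trans (h₂.trans h₃)).symm

variable (α) in
theorem nonempty_homotopyEquiv_circle :
    Nonempty (ContinuousMap.HomotopyEquiv (singlePieceSpace α) Circle) :=
  ⟨⟨windingMap α, modelLoop α, modelLoop_comp_windingMap_homotopic,
    windingMap_comp_modelLoop_homotopic⟩⟩

end SinglePiece

/-! ### The pieces as hypersurfaces -/

section Pieces

variable {N : ℕ} (α : SplitIndex N)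

theorem mem_splitPiece_iff {α : SplitIndex N} {p : Config N} :
    p ∈ splitPiece α ↔ (p α.i 0 = p α.j 0 ∧ p α.i 1 < p α.j 1 ∧
      ∀ n : Set.Ioo α.i α.j, 0 ≤ (α.σ n).toReal * (p n 0 - p α.i 0)) ∧
      p ∈ coordinationSpace N :=
  and_congr_left' mem_splitHalfHyperplane_iff

theorem isOpen_coordinationSpace (N : ℕ) : IsOpen (coordinationSpace N) := isOpen_univ.sdiff <|
  isClosed_iUnion_of_finite fun i ↦ isClosed_iUnion_of_finite fun j ↦
    isClosed_iUnion_of_finite fun _ ↦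
      (isClosed_eq (f := fun p : Config N ↦ p i 0) (by fun_prop) (by fun_prop)).inter
        (isClosed_eq (by fun_prop) (by fun_prop))

/-- The piece is closed in the coordination space, although `y_i < y_j` is a strict condition: where
`x_i = x_j`, equality of `y_i` and `y_j` would be a collision. -/
theorem closure_splitPiece_inter :
    closure (splitPiece α) ∩ coordinationSpace N = splitPiece α := by
  refine Set.Subset.antisymm ?_ fun p hp ↦ ⟨subset_closure hp, hp.2⟩
  rintro p ⟨hp, hX⟩
  have hcl : IsClosed {p : Config N | p α.i 0 = p α.j 0 ∧ p α.i 1 ≤ p α.j 1 ∧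
      ∀ n : Set.Ioo α.i α.j, 0 ≤ (α.σ n).toReal * (p n 0 - p α.i 0)} := by
    simp only [Set.ofPred_and, Set.ofPred_forall]
    refine (isClosed_eq (by fun_prop) (by fun_prop)).inter
      ((isClosed_le (by fun_prop) (by fun_prop)).inter
      (isClosed_iInter fun n ↦ isClosed_le (by fun_prop) (by fun_prop)))
  obtain ⟨h1, h2, h3⟩ := hcl.closure_subset_iff.2
    (fun q hq ↦ have h := (mem_splitPiece_iff.1 hq).1; ⟨h.1, h.2.1.le, h.2.2⟩) hp
  exact mem_splitPiece_iff.2 ⟨⟨h1, lt_of_le_of_ne h2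
    (mem_coordinationSpace_iff.1 hX _ _ α.lt h1), h3⟩, hX⟩

/-- The linear form `x_i - x_j`, whose kernel contains the piece. -/
noncomputable def pieceForm : Config N →L[ℝ] ℝ :=
  (EuclideanSpace.proj 0).comp (ContinuousLinearMap.proj α.i) -
    (EuclideanSpace.proj 0).comp (ContinuousLinearMap.proj α.j)

@[simp] theorem pieceForm_apply (p : Config N) : pieceForm α p = p α.i 0 - p α.j 0 := rfl

/-- The linear form `±(x_n - x_i)` that is nonnegative on the piece. -/
noncomputable def pieceWallForm (n : Set.Ioo α.i α.j) : Config N →L[ℝ] ℝ :=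
  (α.σ n).toReal • ((EuclideanSpace.proj 0).comp (ContinuousLinearMap.proj (n : Fin N)) -
    (EuclideanSpace.proj 0).comp (ContinuousLinearMap.proj α.i))

@[simp] theorem pieceWallForm_apply (n : Set.Ioo α.i α.j) (p : Config N) :
    pieceWallForm α n p = (α.σ n).toReal * (p n 0 - p α.i 0) := rfl

/-- The coordinates of `Config N` adapted to a piece: `x_j` is replaced by `x_i - x_j`, and `x_n` by
`±(x_n - x_i)` for the robots `n` between `i` and `j`. -/
noncomputable def pieceCoordinate (p : Config N) (k : Fin N) : ℝ :=
  if k = α.j then p α.i 0 - p α.j 0 else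
    if h : k ∈ Set.Ioo α.i α.j then (α.σ ⟨k, h⟩).toReal * (p k 0 - p α.i 0) else p k 0

/-- The inverse of `pieceCoordinate` on first coordinates. -/
noncomputable def pieceCoordinateInv (u : Fin N → ℝ) (k : Fin N) : ℝ :=
  if k = α.j then u α.i - u α.j else
    if h : k ∈ Set.Ioo α.i α.j then u α.i + (α.σ ⟨k, h⟩).toReal * u k else u k

variable {α}

theorem pieceCoordinate_i (p : Config N) : pieceCoordinate α p α.i = p α.i 0 := by
  simp [pieceCoordinate, α.lt.ne]

theorem pieceCoordinate_j (p : Config N) : pieceCoordinate α p α.j = p α.i 0 - p α.j 0 := by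
  simp [pieceCoordinate]

theorem pieceCoordinate_between (p : Config N) (n : Set.Ioo α.i α.j) :
    pieceCoordinate α p n = (α.σ n).toReal * (p n 0 - p α.i 0) := by
  have h := n.2
  simp [pieceCoordinate, h.2.ne]

theorem pieceCoordinateInv_i (u : Fin N → ℝ) : pieceCoordinateInv α u α.i = u α.i := by
  simp [pieceCoordinateInv, α.lt.ne]

variable (α)

/-- A linear coordinate system in which the piece is cut out by coordinates. -/
noncomputable def pieceChart : Config N ≃L[ℝ] (Fin (2 * N) → ℝ) :=
  LinearEquiv.toContinuousLinearEquiv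
  { toFun := fun p m ↦ if (finProdFinEquiv.symm m).1 = 0 then
        pieceCoordinate α p (finProdFinEquiv.symm m).2 else p (finProdFinEquiv.symm m).2 1
    invFun := fun u ↦ mkConfig (pieceCoordinateInv α fun k ↦ u (finProdFinEquiv (0, k)))
      fun k ↦ u (finProdFinEquiv (1, k))
    map_add' := fun p q ↦ by
      ext m
      simp only [pieceCoordinate, Pi.add_apply, PiLp.add_apply]
      split_ifs <;> ring
    map_smul' := fun c p ↦ by
      ext m
      simp only [pieceCoordinate, Pi.smul_apply, PiLp.smul_apply, smul_eq_mul, RingHom.id_apply]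
      split_ifs <;> ring
    left_inv := fun p ↦ by
      ext k a
      fin_cases a
      · simp only [Equiv.symm_apply_apply, if_true]
        change pieceCoordinateInv α (pieceCoordinate α p) k = p k 0
        unfold pieceCoordinateInv
        split_ifs with h1 h2
        · subst h1
          rw [pieceCoordinate_i, pieceCoordinate_j]
          ring
        · have := (α.σ ⟨k, h2⟩).toReal_mul_self
          rw [pieceCoordinate_i, pieceCoordinate_between p ⟨k, h2⟩]
          linear_combination (p k 0 - p α.i 0) * this
        · simp [pieceCoordinate, h1, h2]
      · simp [mkConfig]
    right_inv := fun u ↦ by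
      ext m
      obtain ⟨⟨a, k⟩, rfl⟩ := finProdFinEquiv.surjective m
      simp only [Equiv.symm_apply_apply]
      fin_cases a
      · simp only [pieceCoordinate, mkConfig_apply_zero, pieceCoordinateInv_i]
        simp only [pieceCoordinateInv, Fin.zero_eta, if_true]
        split_ifs with h1 h2
        · subst h1
          ring
        · have := (α.σ ⟨k, h2⟩).toReal_mul_self
          linear_combination u (finProdFinEquiv (0, k)) * this
        · rfl
      · simp }

theorem pieceChart_apply_zero (p : Config N) (k : Fin N) :
    pieceChart α p (finProdFinEquiv (0, k)) = pieceCoordinate α p k := by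
  change (if (finProdFinEquiv.symm (finProdFinEquiv ((0 : Fin 2), k))).1 = 0 then
    pieceCoordinate α p (finProdFinEquiv.symm (finProdFinEquiv ((0 : Fin 2), k))).2 else _) = _
  rw [Equiv.symm_apply_apply]
  rfl

/-- A subset which agrees, on an open set, with a coordinate corner of a linear chart. -/
theorem hasCornerChartAt_of_continuousLinearEquiv {E : Type*} [NormedAddCommGroup E]
    [NormedSpace ℝ E] {D : ℕ} {S U : Set E} {p : E} {c : Fin D} {J : Set (Fin D)}
    (e : E ≃L[ℝ] (Fin D → ℝ)) (hU : IsOpen U) (hp : p ∈ U)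
    (h : ∀ q ∈ U, q ∈ S ↔ e q c = 0 ∧ ∀ k ∈ J, 0 ≤ e q k) : HasCornerChartAt D S p c J := by
  refine ⟨e.toHomeomorph.toOpenPartialHomeomorph.restrOpen U hU, ?_, ?_, ?_, ?_⟩
  · simpa using hp
  · exact e.contDiff.contDiffOn
  · exact e.symm.contDiff.contDiffOn
  · ext u
    obtain ⟨q, rfl⟩ := e.surjective u
    constructor
    · rintro ⟨q', ⟨hS, hq'⟩, he⟩
      obtain rfl : q' = q := e.injective he
      have hqU : q' ∈ U := hq'.2
      exact ⟨⟨Set.mem_univ _, by simpa using hqU⟩, (h q' hqU).1 hS⟩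
    · rintro ⟨hu, hcJ⟩
      have hqU : q ∈ U := by simpa using hu
      exact ⟨q, ⟨(h q hqU).2 hcJ, Set.mem_univ _, hqU⟩, rfl⟩

variable {α}

/-- On this open set the piece is cut out by `x_i = x_j` and the inequalities `pieceWallForm ≥ 0`. -/
theorem isOpen_pieceDomain : IsOpen ({p : Config N | p α.i 1 < p α.j 1} ∩ coordinationSpace N) :=
  (isOpen_lt (by fun_prop) (by fun_prop)).inter (isOpen_coordinationSpace N)

variable (α) in
theorem isHypersurfaceWithCorners_splitPiece :
    IsHypersurfaceWithCorners (2 * N) (splitPiece α) := by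
  intro p hp
  refine ⟨finProdFinEquiv (0, α.j), (fun k ↦ finProdFinEquiv (0, k)) '' Set.Ioo α.i α.j, ?_,
    hasCornerChartAt_of_continuousLinearEquiv (pieceChart α) isOpen_pieceDomain
      ⟨(mem_splitPiece_iff.1 hp).1.2.1, hp.2⟩ fun q hq ↦ ?_⟩
  · rintro ⟨k, hk, h⟩
    have := congrArg Prod.snd (finProdFinEquiv.injective h)
    exact hk.2.ne this
  · rw [mem_splitPiece_iff, Set.forall_mem_image, pieceChart_apply_zero, pieceCoordinate_j,
      sub_eq_zero]
    constructor
    · rintro ⟨⟨h1, _, h3⟩, -⟩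
      refine ⟨h1, fun k hk ↦ ?_⟩
      rw [pieceChart_apply_zero, pieceCoordinate_between q ⟨k, hk⟩]
      exact h3 ⟨k, hk⟩
    · rintro ⟨h1, h3⟩
      refine ⟨⟨h1, hq.1, fun n ↦ ?_⟩, hq.2⟩
      have := h3 n.2
      rwa [pieceChart_apply_zero, pieceCoordinate_between q n] at this

/-- Away from the walls `x_n = x_i` the piece is a hypersurface without boundary. -/
theorem hasCornerChartAt_splitPiece {p : Config N} (hp : p ∈ splitPiece α)
    (h : ∀ n, 0 < pieceWallForm α n p) :
    HasCornerChartAt (2 * N) (splitPiece α) p (finProdFinEquiv (0, α.j)) ∅ := by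
  refine hasCornerChartAt_of_continuousLinearEquiv (pieceChart α)
    (isOpen_pieceDomain.inter (isOpen_iInter_of_finite fun n : Set.Ioo α.i α.j ↦
      isOpen_lt continuous_const (pieceWallForm α n).continuous))
    ⟨⟨(mem_splitPiece_iff.1 hp).1.2.1, hp.2⟩, Set.mem_iInter.2 h⟩ fun q hq ↦ ?_
  rw [mem_splitPiece_iff, pieceChart_apply_zero, pieceCoordinate_j, sub_eq_zero]
  constructor
  · rintro ⟨⟨h1, -⟩, -⟩
    exact ⟨h1, fun k hk ↦ hk.elim⟩
  · rintro ⟨h1, -⟩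
    exact ⟨⟨h1, hq.1.1, fun n ↦ le_of_lt (Set.mem_iInter.1 hq.2 n)⟩, hq.1.2⟩

variable (α) in
theorem hypersurfaceBoundary_splitPiece_subset : hypersurfaceBoundary (2 * N) (splitPiece α) ⊆
    ⋃ (β : SplitIndex N) (_ : β ≠ α), splitPiece β := by
  rintro p ⟨hp, hb⟩
  have hw : ∃ n, pieceWallForm α n p ≤ 0 := by
    by_contra! h
    exact hb ⟨_, hasCornerChartAt_splitPiece hp h⟩
  obtain ⟨n, hn⟩ := hw
  obtain ⟨β, hβ, h⟩ := exists_ne_mem_splitHalfHyperplane (mem_splitPiece_iff.1 hp).1.1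
    (mem_splitPiece_iff.1 hp).1.2.1 n hn
  exact Set.mem_iUnion₂.2 ⟨β, hβ, h, hp.2⟩

variable (α) in
/-- A direction in the hyperplane `x_i = x_j` that points strictly inside all walls of the piece. -/
noncomputable def inwardVector : Config N :=
  mkConfig (fun k ↦ if h : k ∈ Set.Ioo α.i α.j then (α.σ ⟨k, h⟩).toReal else 0) 0

theorem inwardVector_i : inwardVector α α.i 0 = 0 := by simp [inwardVector]

theorem inwardVector_j : inwardVector α α.j 0 = 0 := by simp [inwardVector]

theorem pieceForm_inwardVector : pieceForm α (inwardVector α) = 0 := by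
  rw [pieceForm_apply, inwardVector_i, inwardVector_j, sub_zero]

theorem pieceWallForm_inwardVector (n : Set.Ioo α.i α.j) :
    pieceWallForm α n (inwardVector α) = 1 := by
  rw [pieceWallForm_apply, inwardVector_i, sub_zero, ← (α.σ n).toReal_mul_self]
  have h := n.2
  simp [inwardVector, h.1, h.2]

open Filter in
/-- A vector of the hyperplane `x_i = x_j` that points inside all walls can be followed inside the
piece. -/
theorem eventually_add_smul_mem_splitPiece {p v : Config N} (hp : p ∈ splitPiece α)
    (hv : pieceForm α v = 0) (hw : ∀ n, 0 ≤ pieceWallForm α n v) :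
    ∀ᶠ t : ℝ in 𝓝[>] 0, p + t • v ∈ splitPiece α := by
  obtain ⟨⟨h1, h2, h3⟩, hX⟩ := mem_splitPiece_iff.1 hp
  have hc : ContinuousAt (fun t : ℝ ↦ p + t • v) 0 := by fun_prop
  have hU : ({p : Config N | p α.i 1 < p α.j 1} ∩ coordinationSpace N) ∈
      𝓝 (p + (0 : ℝ) • v) := by
    refine isOpen_pieceDomain.mem_nhds ?_
    rw [zero_smul, add_zero]
    exact ⟨h2, hX⟩
  filter_upwards [(hc.eventually_mem hU).filter_mono nhdsWithin_le_nhds, self_mem_nhdsWithin]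
    with t ht ht0
  have ht0 : 0 < t := ht0
  refine mem_splitPiece_iff.2 ⟨⟨?_, ht.1, fun n ↦ ?_⟩, ht.2⟩
  · rw [← sub_eq_zero, ← pieceForm_apply, map_add, map_smul, hv, smul_zero, add_zero,
      pieceForm_apply, h1, sub_self]
  · rw [← pieceWallForm_apply, map_add, map_smul, smul_eq_mul]
    have := h3 n
    rw [← pieceWallForm_apply] at this
    have := mul_nonneg ht0.le (hw n)
    linarith

theorem hypersurfaceTangentSpace_splitPiece {p : Config N} (hp : p ∈ splitPiece α) :
    hypersurfaceTangentSpace (splitPiece α) p = (pieceForm α).toLinearMap.ker := by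
  apply le_antisymm
  · refine Submodule.span_le.2 fun v hv ↦ ?_
    obtain ⟨ι, l, hl, c, d, -, hs, hcd⟩ := exists_fun_of_mem_tangentConeAt hv
    have h0 : (fun n ↦ pieceForm α (c n • d n)) =ᶠ[l] fun _ ↦ 0 := by
      filter_upwards [hs] with n hn
      have h1 : pieceForm α (p + d n) = 0 := sub_eq_zero.2 (mem_splitPiece_iff.1 hn).1.1
      have h2 : pieceForm α p = 0 := sub_eq_zero.2 (mem_splitPiece_iff.1 hp).1.1
      rw [map_add, h2, zero_add] at h1
      rw [map_smul, h1, smul_zero]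
    exact tendsto_nhds_unique
      (((pieceForm α).continuous.tendsto v).comp hcd) (tendsto_const_nhds.congr' h0.symm)
  · intro v hv
    have hv : pieceForm α v = 0 := hv
    have key {w : Config N} (h : pieceForm α w = 0) (hw : ∀ n, 0 ≤ pieceWallForm α n w) :
        w ∈ hypersurfaceTangentSpace (splitPiece α) p :=
      Submodule.subset_span (mem_tangentConeAt_of_add_smul_mem
        (Filter.tendsto_id'.2 (nhdsGT_le_nhdsNE 0)) (eventually_add_smul_mem_splitPiece hp h hw))
    obtain ⟨C, hC⟩ := Finite.exists_le fun n ↦ |pieceWallForm α n v|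
    -- Adding a large multiple of the inward vector makes any tangent vector point inwards.
    have h1 : v + C • inwardVector α ∈ hypersurfaceTangentSpace (splitPiece α) p := by
      refine key (by rw [map_add, map_smul, hv, pieceForm_inwardVector, smul_zero, add_zero])
        fun n ↦ ?_
      rw [map_add, map_smul, pieceWallForm_inwardVector, smul_eq_mul, mul_one]
      linarith [hC n, neg_abs_le (pieceWallForm α n v)]
    have h2 : inwardVector α ∈ hypersurfaceTangentSpace (splitPiece α) p :=
      key pieceForm_inwardVector fun n ↦ by rw [pieceWallForm_inwardVector]; exact zero_le_one
    simpa using Submodule.sub_mem _ h1 (Submodule.smul_mem _ C h2)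

variable (α) in
theorem isOrientableHypersurface_splitPiece : IsOrientableHypersurface (splitPiece α) := by
  refine ⟨fun _ ↦ pieceForm α, continuousOn_const, fun p hp ↦ ⟨fun h ↦ ?_,
    (hypersurfaceTangentSpace_splitPiece hp).symm⟩⟩
  have := congrArg (fun f ↦ f (mkConfig (Pi.single α.i 1) 0)) h
  simp [α.lt.ne'] at this

/-- The tangent hyperplanes `x_i = x_j` and `x_k = x_l` of different pairs are different. -/
theorem hypersurfaceTangentSpace_sup_eq_top {β : SplitIndex N} {p : Config N}
    (hα : p ∈ splitPiece α) (hβ : p ∈ splitPiece β) (h : (α.i, α.j) ≠ (β.i, β.j)) :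
    hypersurfaceTangentSpace (splitPiece α) p ⊔
      hypersurfaceTangentSpace (splitPiece β) p = ⊤ := by
  rw [hypersurfaceTangentSpace_splitPiece hα, hypersurfaceTangentSpace_splitPiece hβ, eq_top_iff]
  have hw : ∃ w : Config N, pieceForm α w = 0 ∧ pieceForm β w = 1 := by
    by_cases hi : β.i = α.i ∨ β.i = α.j
    · refine ⟨mkConfig (Pi.single β.j (-1)) 0, ?_, ?_⟩
      · have h1 : α.i ≠ β.j := by
          rintro h1
          have := α.lt
          have := β.lt
          rcases hi with hi | hi <;> omega
        have h2 : α.j ≠ β.j := by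
          rintro h2
          have := α.lt
          have := β.lt
          rcases hi with hi | hi
          · exact h (by rw [hi, h2])
          · omega
        simp [h1, h2]
      · simp [β.lt.ne]
    · push Not at hi
      refine ⟨mkConfig (Pi.single β.i 1) 0, ?_, ?_⟩
      · simp [hi.1.symm, hi.2.symm]
      · simp [β.lt.ne']
  obtain ⟨w, h1, h2⟩ := hw
  intro v _
  refine Submodule.mem_sup.2 ⟨pieceForm β v • w, ?_, v - pieceForm β v • w, ?_, by abel⟩
  · change pieceForm α _ = 0
    rw [map_smul, h1, smul_zero]
  · change pieceForm β _ = 0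
    rw [map_sub, map_smul, h2, smul_eq_mul, mul_one, sub_self]

theorem hasDerivAt_line {F : Type*} [NormedAddCommGroup F] [NormedSpace ℝ F] (a b : F) :
    HasDerivAt (fun t : ℝ ↦ a + t • b) b 0 := by
  simpa using ((hasDerivAt_id (0 : ℝ)).smul_const b).const_add a

open Filter in
/-- A point `p` of `S` is a boundary point if a linear form has a minimum on `S` at `p` and increases
along some half-line in `S` from `p`: in a chart, that half-line would extend to a curve in `S`
passing through `p` in both directions. -/
theorem mem_hypersurfaceBoundary_of_linear_min {E : Type*} [NormedAddCommGroup E]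
    [NormedSpace ℝ E] {D : ℕ} {S : Set E} {p v : E} (hp : p ∈ S) (ℓ : E →L[ℝ] ℝ)
    (hmin : ∀ q ∈ S, ℓ p ≤ ℓ q) (hv : ∀ᶠ t : ℝ in 𝓝[>] 0, p + t • v ∈ S) (hℓ : ℓ v ≠ 0) :
    p ∈ hypersurfaceBoundary D S := by
  refine ⟨hp, ?_⟩
  rintro ⟨c, φ, hps, hφ, hφ', himg⟩
  have hpt : φ p ∈ φ.target := φ.map_source hps
  have hS {q : E} (hq : q ∈ φ.source) : q ∈ S ↔ φ q c = 0 := by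
    constructor
    · intro h
      have : φ q ∈ φ '' (S ∩ φ.source) := ⟨q, ⟨h, hq⟩, rfl⟩
      rw [himg] at this
      exact this.2.1
    · intro h
      have : φ q ∈ φ '' (S ∩ φ.source) := by
        rw [himg]
        exact ⟨φ.map_source hq, h, fun k hk ↦ hk.elim⟩
      obtain ⟨q', hq', he⟩ := this
      exact φ.injOn hq'.2 hq he ▸ hq'.1
  have hd : HasFDerivAt φ (fderiv ℝ φ p) p :=
    ((hφ.contDiffAt (φ.open_source.mem_nhds hps)).differentiableAt (by simp)).hasFDerivAt
  have hd' : HasFDerivAt φ.symm (fderiv ℝ φ.symm (φ p)) (φ p) :=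
    ((hφ'.contDiffAt (φ.open_target.mem_nhds hpt)).differentiableAt (by simp)).hasFDerivAt
  set A := fderiv ℝ φ p
  set B := fderiv ℝ φ.symm (φ p)
  have hBA : B (A v) = v := by
    have h1 : HasFDerivAt (φ.symm ∘ φ) (B.comp A) p := hd'.comp p hd
    have h2 : HasFDerivAt (φ.symm ∘ φ) (ContinuousLinearMap.id ℝ E) p :=
      (hasFDerivAt_id p).congr_of_eventuallyEq (φ.eventually_left_inverse hps)
    exact congrArg (fun f ↦ f v) (h1.unique h2)
  -- The half-line is tangent to the hyperplane `u c = 0` in the chart.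
  have hAv : A v c = 0 := by
    have h1 : HasDerivAt (fun t : ℝ ↦ φ (p + t • v) c) (A v c) 0 := by
      have hd0 : HasFDerivAt φ A (p + (0 : ℝ) • v) := by simpa using hd
      exact hasDerivAt_pi.1 (hd0.comp_hasDerivAt (0 : ℝ) (hasDerivAt_line p v)) c
    have h2 : HasDerivWithinAt (fun t : ℝ ↦ φ (p + t • v) c) 0 (Set.Ioi 0) 0 := by
      have hsrc : ∀ᶠ t : ℝ in 𝓝[>] 0, p + t • v ∈ φ.source := by
        have hc : ContinuousAt (fun t : ℝ ↦ p + t • v) 0 := by fun_prop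
        exact (hc.eventually_mem (φ.open_source.mem_nhds (by simpa using hps))).filter_mono
          nhdsWithin_le_nhds
      refine (hasDerivWithinAt_const (0 : ℝ) (Set.Ioi 0) (0 : ℝ)).congr_of_eventuallyEq ?_ ?_
      · filter_upwards [hsrc, hv] with t h h' using (hS h).1 h'
      · simpa using (hS hps).1 hp
    exact (uniqueDiffWithinAt_Ioi (0 : ℝ)).eq_deriv _ h1.hasDerivWithinAt h2
  -- A straight line in the chart is a curve in `S` with the same tangent vector.
  have hcurve : HasDerivAt (fun t : ℝ ↦ ℓ (φ.symm (φ p + t • A v))) (ℓ v) 0 := by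
    have hd0 : HasFDerivAt φ.symm B (φ p + (0 : ℝ) • A v) := by simpa using hd'
    have := ℓ.hasFDerivAt.comp_hasDerivAt (0 : ℝ)
      (hd0.comp_hasDerivAt (0 : ℝ) (hasDerivAt_line (φ p) (A v)))
    rwa [hBA] at this
  refine hℓ (IsLocalMin.hasDerivAt_eq_zero (a := (0 : ℝ)) ?_ hcurve)
  have hc : ContinuousAt (fun t : ℝ ↦ φ p + t • A v) 0 := by fun_prop
  filter_upwards [hc.eventually_mem (φ.open_target.mem_nhds (by simpa using hpt))] with t ht
  rw [zero_smul, add_zero, φ.left_inv hps]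
  refine hmin _ ((hS (φ.map_target ht)).2 ?_)
  rw [φ.right_inv ht, Pi.add_apply, Pi.smul_apply, hAv, smul_zero, add_zero]
  exact (hS hps).1 hp

theorem mem_hypersurfaceBoundary_splitPiece {p : Config N} (hp : p ∈ splitPiece α)
    {n : Set.Ioo α.i α.j} (hn : p n 0 = p α.i 0) :
    p ∈ hypersurfaceBoundary (2 * N) (splitPiece α) := by
  refine mem_hypersurfaceBoundary_of_linear_min hp (pieceWallForm α n) (fun q hq ↦ ?_)
    (eventually_add_smul_mem_splitPiece hp pieceForm_inwardVector fun m ↦ ?_) ?_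
  · rw [pieceWallForm_apply, hn, sub_self, mul_zero]
    exact (mem_splitPiece_iff.1 hq).1.2.2 n
  · rw [pieceWallForm_inwardVector]
    exact zero_le_one
  · rw [pieceWallForm_inwardVector]
    exact one_ne_zero

theorem mem_hypersurfaceBoundary_inter {β : SplitIndex N} (hne : α ≠ β) {p : Config N}
    (hα : p ∈ splitPiece α) (hβ : p ∈ splitPiece β) (h : (α.i, α.j) = (β.i, β.j)) :
    p ∈ hypersurfaceBoundary (2 * N) (splitPiece α) ∩
      hypersurfaceBoundary (2 * N) (splitPiece β) := by
  obtain ⟨i, j, hij, σ⟩ := α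
  obtain ⟨k, l, hkl, τ⟩ := β
  obtain ⟨rfl, rfl⟩ := Prod.mk.inj h
  have hστ : σ ≠ τ := by rintro rfl; exact hne rfl
  obtain ⟨n, hn⟩ := Function.ne_iff.1 hστ
  have h1 := (mem_splitPiece_iff.1 hα).1.2.2 n
  have h2 := (mem_splitPiece_iff.1 hβ).1.2.2 n
  have h3 := (σ n).toReal_mul_self
  simp only at h1 h2
  have h4 := PieceSign.toReal_eq_neg_of_ne hn
  have hx : p n 0 = p i 0 := by
    have h5 : (σ n).toReal * (p n 0 - p i 0) = 0 := le_antisymm (by rw [h4]; linarith) h1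
    have h6 : (σ n).toReal ≠ 0 := fun h0 ↦ by rw [h0] at h3; norm_num at h3
    linarith [(mul_eq_zero.1 h5).resolve_left h6]
  exact ⟨mem_hypersurfaceBoundary_splitPiece hα (n := n) hx,
    mem_hypersurfaceBoundary_splitPiece hβ (n := n) hx⟩

end Pieces

theorem mainTheorem4 (N : ℕ) :
    -- the fundamental group of each `X_{i,j/σ}` is infinite cyclic
    (∀ α : SplitIndex N, IsPathConnected (singlePieceSpace α) ∧
      ∀ q : singlePieceSpace α,
        Nonempty (FundamentalGroup (singlePieceSpace α) q ≃* Multiplicative ℤ)) ∧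
    -- the coordination space is a `2N`-manifold without boundary
    IsOpen (coordinationSpace N) ∧
    -- the pieces are closed orientable hypersurfaces in it, with boundary inside other pieces
    (∀ α : SplitIndex N,
      IsHypersurfaceWithCorners (2 * N) (splitPiece α) ∧
      IsOrientableHypersurface (splitPiece α) ∧
      closure (splitPiece α) ∩ coordinationSpace N = splitPiece α ∧
      hypersurfaceBoundary (2 * N) (splitPiece α) ⊆
        ⋃ (β : SplitIndex N) (_ : β ≠ α), splitPiece β) ∧
    -- pieces of different half-hyperplanes have transverse tangent spaces, pieces of the same
    -- half-hyperplane meet only along their boundaries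
    (∀ α β : SplitIndex N, α ≠ β → ∀ p ∈ splitPiece α ∩ splitPiece β,
      ((α.i, α.j) ≠ (β.i, β.j) →
        hypersurfaceTangentSpace (splitPiece α) p ⊔
          hypersurfaceTangentSpace (splitPiece β) p = ⊤) ∧
      ((α.i, α.j) = (β.i, β.j) →
        p ∈ hypersurfaceBoundary (2 * N) (splitPiece α) ∩
          hypersurfaceBoundary (2 * N) (splitPiece β))) ∧
    -- the complement of all the pieces is path connected and simply connected
    SimplyConnectedSpace
      ↥(coordinationSpace N \ ⋃ α : SplitIndex N, splitHalfHyperplane α) := by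
  refine ⟨fun α ↦ ?_, isOpen_coordinationSpace N, fun α ↦
    ⟨isHypersurfaceWithCorners_splitPiece α, isOrientableHypersurface_splitPiece α,
      closure_splitPiece_inter α, hypersurfaceBoundary_splitPiece_subset α⟩,
    fun α β hne p hp ↦ ⟨hypersurfaceTangentSpace_sup_eq_top hp.1 hp.2,
      mem_hypersurfaceBoundary_inter hne hp.1 hp.2⟩, simplyConnectedSpace_compl_pieces N⟩
  obtain ⟨e⟩ := nonempty_homotopyEquiv_circle α
  refine ⟨isPathConnected_iff_pathConnectedSpace.2 e.pathConnectedSpace, fun q ↦ ?_⟩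
  obtain ⟨y, ⟨f⟩⟩ := e.nonempty_fundamentalGroup_mulEquiv q
  exact (Circle.nonempty_fundamentalGroup_mulEquiv y).map f.trans
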